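/- Let $\alpha,\beta,\gamma>0$ and $0<c<1$, and let $w_k=\frac{(\alpha)_k(\beta)_k}{(\gamma)_k\,k!}c^k$ for $k\in\mathbb N=\{0,1,2,\dots\}$. Let $(p_n)_{n\ge 0}$ be the orthonormal polynomials with positive leading coefficients, $\sum_{k=0}^\infty p_m(k)p_n(k)w_k=\delta_{m,n}$, $\deg p_n=n$, and let $a_n,b_n$ be their recurrence coefficients, $xp_n(x)=a_{n+1}p_{n+1}(x)+b_np_n(x)+a_np_{n-1}(x)$ with $a_0=0$. Put $u(x)=-1+\frac{(\gamma+x-1)x}{c(\alpha+x-1)(\beta+x-1)}$, with $u(0)=-1$ also when $\alpha=1$ or $\beta=1$, and define the (normalized) ladder-operator coefficients $$\frac{A_n(x)}{a_n}:=\sum_{k=0}^\infty p_n(k)p_n(k-1)\frac{u(x+1)-u(k)}{x+1-k}w_k,\qquad B_n(x):=a_n\sum_{k=0}^\infty p_n(k)p_{n-1}(k-1)\frac{u(x+1)-u(k)}{x+1-k}w_k ,$$ with $B_0=0$. Then $p_n$, $a_n$, $b_n$ exist, and there are real sequences $(x_n)_{n\ge0}$, $(y_n)_{n\ge0}$ such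 that, for all $n\ge 0$ and all real $x$ with $x\ne-\alpha$, $x\neq-\beta$ and $x+1\notin\mathbb N$, both series converge and $$\frac{A_n(x)}{a_n}=\frac{1-c}{c}\,\frac{x+x_n}{(x+\alpha)(x+\beta)},\qquad B_n(x)=\frac{-nx+y_n}{(x+\alpha)(x+\beta)} .$$ These sequences satisfy, for all $n\ge0$, $$\big(y_n-\alpha\beta+(\alpha+\beta+n)x_n-x_n^2\big)\big(y_{n+1}-\alpha\beta+(\alpha+\beta+n+1)x_n-x_n^2\big)=\frac1c(x_n-1)(x_n-\alpha)(x_n-\beta)(x_n-\gamma).$$ Further, let $$D_n=y_n(2n+\alpha+\beta-\gamma-1)+n\big((n+\alpha+\beta)(n+\alpha+\beta-\gamma-1)-\alpha\beta+\gamma\big),$$ $$N_n=y_n^2+y_n\big(n(n+\alpha+\beta-\gamma-1)-\alpha\beta+\gamma\big)-\alpha\beta n(n+\alpha+\beta-\gamma-1),$$ $$Q_n=(y_n+n\alpha)(y_n+n\beta)\big(y_n+n\gamma-(\gamma-\alpha)(\gamma-\beta)\big)\big(y_n+n-(1-\alpha)(1-\beta)\big).$$ Then for every $n\ge1$ with $D_n\ne0$,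 $$(x_n+Y_n)(x_{n-1}+Y_n)=\frac{Q_n}{D_n^2},\qquad Y_n=\frac{N_n}{D_n},$$ and, for every $n\ge1$ without exception, $(D_nx_n+N_n)(D_nx_{n-1}+N_n)=Q_n$. The initial values are $$y_0=0,\qquad x_0=\frac{c\alpha\beta}{\gamma}\,\frac{{}_2F_1(\alpha+1,\beta+1;\gamma+1;c)}{{}_2F_1(\alpha,\beta;\gamma;c)}-\frac{(\alpha+\beta)c-\gamma}{1-c},$$ and the recurrence coefficients are given for all $n\ge 0$ by $$b_n=x_n+\frac{n+(n+\alpha+\beta)c-\gamma}{1-c},\qquad \frac{1-c}{c}a_n^2=y_n+\sum_{k=0}^{n-1}x_k+\frac{n(n+\alpha+\beta-\gamma-1)}{1-c}.$$ -/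

import Mathlib

namespace HypergeometricWeights

/-- The weight `w k = (α)_k (β)_k c ^ k / ((γ)_k k!)` at the point `k` of `ℕ`. -/
noncomputable def weight (α β γ c : ℝ) (k : ℕ) : ℝ :=
  (ascPochhammer ℝ k).eval α * (ascPochhammer ℝ k).eval β /
    ((ascPochhammer ℝ k).eval γ * (k.factorial : ℝ)) * c ^ k

/-- `p` is the sequence of orthonormal polynomials on `ℕ` for the weights `w`:
`p n` has degree `n` and positive leading coefficient, and
`∑ k, p m (k) * p n (k) * w k` is `1` if `m = n` and `0` otherwise. -/
structure IsOrthonormalPolynomials (w : ℕ → ℝ) (p : ℕ → Polynomial ℝ) : Prop where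
  natDegree_eq : ∀ n, (p n).natDegree = n
  leadingCoeff_pos : ∀ n, 0 < (p n).leadingCoeff
  orthonormal : ∀ m n, HasSum (fun k : ℕ => (p m).eval (k : ℝ) * (p n).eval (k : ℝ) * w k)
    (if m = n then 1 else 0)

/-- `a`, `b` are the recurrence coefficients of the polynomials `p`:
`x p_n = a_{n+1} p_{n+1} + b_n p_n + a_n p_{n-1}` with `a_0 = 0`
(so that the term with `p_{n-1}` is absent for `n = 0`). -/
structure IsRecurrenceCoefficients (p : ℕ → Polynomial ℝ) (a b : ℕ → ℝ) : Prop where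
  a_zero : a 0 = 0
  recurrence : ∀ n, Polynomial.X * p n =
    Polynomial.C (a (n + 1)) * p (n + 1) + Polynomial.C (b n) * p n +
      Polynomial.C (a n) * p (n - 1)

/-- The discrete potential `u(x) = -(w(x) - w(x-1)) / w(x)` of the weight, as a rational function.
On `ℕ` its denominator can only vanish at `x = 0` (when `α = 1` or `β = 1`). There the convention
`0 / 0 = 0` gives `u(0) = -1`, which is `-(w_0 - w_{-1}) / w_0` with `w_{-1} = 0`, in agreement
with all other values of `α` and `β`. -/
noncomputable def potential (α β γ c x : ℝ) : ℝ :=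
  -1 + (γ + x - 1) * x / (c * (α + x - 1) * (β + x - 1))

/-- The divided difference `(u(t+1) - u(k)) / (t + 1 - k)`. -/
noncomputable def kernel (α β γ c t : ℝ) (k : ℕ) : ℝ :=
  (potential α β γ c (t + 1) - potential α β γ c k) / (t + 1 - k)

/-- The `k`-th term of the series that defines the normalized ladder-operator coefficient
`A_n(t) / a_n = ∑ k, p_n(k) p_n(k-1) (u(t+1) - u(k)) / (t + 1 - k) w_k`. -/
noncomputable def ladderATerm (α β γ c : ℝ) (p : ℕ → Polynomial ℝ) (n : ℕ) (t : ℝ) (k : ℕ) : ℝ :=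
  (p n).eval (k : ℝ) * (p n).eval ((k : ℝ) - 1) * kernel α β γ c t k * weight α β γ c k

/-- The `k`-th term of the series that defines the ladder-operator coefficient
`B_n(t) = a_n ∑ k, p_n(k) p_{n-1}(k-1) (u(t+1) - u(k)) / (t + 1 - k) w_k`.
For `n = 0` the factor `a 0 = 0` makes `B_0 = 0`. -/
noncomputable def ladderBTerm (α β γ c : ℝ) (p : ℕ → Polynomial ℝ) (a : ℕ → ℝ)
    (n : ℕ) (t : ℝ) (k : ℕ) : ℝ :=
  a n * ((p n).eval (k : ℝ) * (p (n - 1)).eval ((k : ℝ) - 1) * kernel α β γ c t k *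
    weight α β γ c k)

/-- `x`, `y` are the sequences read off from the ladder-operator coefficients through
`A_n(t) / a_n = (1-c)/c * (t + x_n) / ((t+α)(t+β))` and `B_n(t) = (-n t + y_n) / ((t+α)(t+β))`.
Here `t` runs over all real numbers except the poles `-α`, `-β` and the points `k - 1` with
`k` in `ℕ`, where a divided difference in the series is of the form `0 / 0`. -/
structure IsLadderSequences (α β γ c : ℝ) (p : ℕ → Polynomial ℝ) (a x y : ℕ → ℝ) : Prop where
  ladderA : ∀ (n : ℕ) (t : ℝ), t ≠ -α → t ≠ -β → (∀ k : ℕ, t + 1 ≠ k) →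
    HasSum (ladderATerm α β γ c p n t) ((1 - c) / c * ((t + x n) / ((t + α) * (t + β))))
  ladderB : ∀ (n : ℕ) (t : ℝ), t ≠ -α → t ≠ -β → (∀ k : ℕ, t + 1 ≠ k) →
    HasSum (ladderBTerm α β γ c p a n t) ((-(n : ℝ) * t + y n) / ((t + α) * (t + β)))

/-- The denominator `y(2n+α+β-γ-1) + n((n+α+β)(n+α+β-γ-1) - αβ + γ)`. -/
def den (α β γ n y : ℝ) : ℝ :=
  y * (2 * n + α + β - γ - 1) + n * ((n + α + β) * (n + α + β - γ - 1) - α * β + γ)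

/-- The numerator `y² + y(n(n+α+β-γ-1) - αβ + γ) - αβ n(n+α+β-γ-1)` of `Y_n`. -/
def num (α β γ n y : ℝ) : ℝ :=
  y ^ 2 + y * (n * (n + α + β - γ - 1) - α * β + γ) - α * β * n * (n + α + β - γ - 1)

/-- The product
`(y + nα)(y + nβ)(y + nγ - (γ-α)(γ-β))(y + n - (1-α)(1-β))`. -/
def quartic (α β γ n y : ℝ) : ℝ :=
  (y + n * α) * (y + n * β) * (y + n * γ - (γ - α) * (γ - β)) * (y + n - (1 - α) * (1 - β))

end HypergeometricWeights

namespace HypergeometricWeights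

open Polynomial Finset

/-! Put L f = ∑ f(k) w_k and σ(t) = (t+α)(t+β). Since w_{k+1}/w_k is rational in k, L satisfies the
Pearson relation L(x(x+γ-1) f) = c L(σ f(x+1)) (`weightFunctional_pearson`). The same fact clears
the denominators in the ladder series, so that `hasSum_kernel` turns them into moments of shifted
products. By orthogonality these moments depend only on the leading terms of p_n(x±1)
(`degree_shiftRemainder_lt`). Thus x_n and y_n become explicit in the recurrence coefficients
(`ladderX`, `ladderY`), and the Pearson relation gives two Laguerre–Freud equations.

Write ρ = (1-c)/c, B_n = -nt + y_n and V = (t+1)(t+γ)/c - σ. The Laguerre–Freud equations yield two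
compatibility relations, which telescope to ρ² a_n² (t+x_n)(t+x_{n-1}) = B_n² + V B_n + ρ (∑_{k<n}
(t+x_k)) (σ - B_n). At t = -x_n the left side vanishes; eliminating the sum by the first
compatibility relation leaves (B_n-σ)(B_{n+1}-σ) = σ(σ+V), the first equation.

For the second, let q = σ - B_n. Modulo q the relation makes (1-c)ρ a_n² (t+x_n)(t+x_{n-1})
congruent to (t+1)(t+α)(t+β)(t+γ), whose remainder is N_n - D_n t. So (t+x_n)(t+x_{n-1}) and q have
the same resultant with N_n - D_n t: the former is the product on the left of the second equation,
the latter is the product of the values of q at -1, -α, -β, -γ, which is Q_n. -/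

lemma map_C_mul (L : ℝ[X] →ₗ[ℝ] ℝ) (r : ℝ) (f : ℝ[X]) : L (C r * f) = r * L f := by
  rw [← smul_eq_C_mul, map_smul, smul_eq_mul]

lemma degree_C_mul_le_degree (r : ℝ) (f : ℝ[X]) : (C r * f).degree ≤ f.degree := by
  rw [← smul_eq_C_mul]; exact degree_smul_le r f

/-! ### Orthonormal systems and shifted polynomials -/

/-- The quadratic polynomial `x ^ 2 + s x + q`. -/
noncomputable def quad (s q : ℝ) : ℝ[X] := X ^ 2 + C s * X + C q

/-- The remainder of degree less than `n` in the expansion of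
`(x ^ 2 + s x + q) p_n(x + h)` with leading part a quadratic multiple of `p_n`. -/
noncomputable def shiftRemainder (p : ℕ → ℝ[X]) (b : ℕ → ℝ) (h s q : ℝ) (n : ℕ) : ℝ[X] :=
  quad s q * (p n).comp (X + C h) -
    quad (s + h * n) (q + h * s * n + h ^ 2 * (n * (n - 1) / 2) + h * ∑ k ∈ range n, b k) * p n

/-- `p` is orthonormal for the linear functional `L`, with recurrence coefficients `a`, `b`. -/
structure IsOrthonormalSystem (L : ℝ[X] →ₗ[ℝ] ℝ) (p : ℕ → ℝ[X]) (a b : ℕ → ℝ) : Prop where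
  natDegree_eq : ∀ n, (p n).natDegree = n
  ne_zero : ∀ n, p n ≠ 0
  orthonormal : ∀ m n, L (p m * p n) = if m = n then 1 else 0
  a_zero : a 0 = 0
  recurrence : ∀ n, X * p n = C (a (n + 1)) * p (n + 1) + C (b n) * p n + C (a n) * p (n - 1)

namespace IsOrthonormalSystem

variable {L : ℝ[X] →ₗ[ℝ] ℝ} {p : ℕ → ℝ[X]} {a b : ℕ → ℝ}

section
variable (H : IsOrthonormalSystem L p a b)
include H

lemma map_mul_eq_zero_of_le {m n : ℕ} (hm : m ≤ n) {f : ℝ[X]} (hf : f.degree < m) :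
    L (f * p n) = 0 := by
  induction m generalizing f with
  | zero =>
    have : f = 0 := by
      rw [← degree_eq_bot]
      exact Nat.WithBot.lt_zero_iff.mp (by simpa using hf)
    simp [this]
  | succ m ih =>
    have hlc : (p m).leadingCoeff ≠ 0 := leadingCoeff_ne_zero.mpr (H.ne_zero m)
    have hcm : (p m).coeff m = (p m).leadingCoeff := by
      rw [leadingCoeff, H.natDegree_eq]
    have hg : (f - C (f.coeff m / (p m).leadingCoeff) * p m).degree < m := by
      rw [degree_lt_iff_coeff_zero]
      intro k hk
      rcases hk.eq_or_lt with rfl | hk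
      · rw [coeff_sub, coeff_C_mul, hcm]; field_simp; ring
      · have h1 : f.coeff k = 0 := (degree_lt_iff_coeff_zero _ _).mp hf k hk
        have h2 : (p m).coeff k = 0 := coeff_eq_zero_of_natDegree_lt (by rwa [H.natDegree_eq])
        simp [h1, h2]
    have h0 := ih (by omega) hg
    rw [sub_mul, map_sub, mul_assoc, map_C_mul, H.orthonormal, if_neg (by omega)] at h0
    simpa using h0

lemma degree_eq (n : ℕ) : (p n).degree = n := by
  rw [degree_eq_natDegree (H.ne_zero n), H.natDegree_eq]

lemma a_succ_ne_zero (n : ℕ) : a (n + 1) ≠ 0 := by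
  intro h
  have hr := H.recurrence n
  have hd : (X * p n).degree = ((n + 1 : ℕ) : WithBot ℕ) := by
    rw [degree_mul, degree_X, H.degree_eq]; push_cast; ring
  have hlt : (C (b n) * p n + C (a n) * p (n - 1)).degree < ((n + 1 : ℕ) : WithBot ℕ) := by
    refine (degree_add_le _ _).trans_lt (max_lt ?_ ?_)
    · refine (degree_C_mul_le_degree _ _).trans_lt ?_
      rw [H.degree_eq]; exact_mod_cast Nat.lt_succ_self n
    · refine (degree_C_mul_le_degree _ _).trans_lt ?_
      rw [H.degree_eq]; exact_mod_cast (show n - 1 < n + 1 by omega)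
  rw [h, C_0, zero_mul, zero_add] at hr
  rw [hr] at hd
  exact hlt.ne hd

end

section
variable (H : IsOrthonormalSystem L p a b)
include H

lemma comp_recurrence (h : ℝ) (n : ℕ) :
    C (a (n + 1)) * (p (n + 1)).comp (X + C h) =
      (X + C h - C (b n)) * (p n).comp (X + C h) - C (a n) * (p (n - 1)).comp (X + C h) := by
  have := congrArg (fun f => f.comp (X + C h)) (H.recurrence n)
  simp only [mul_comp, add_comp, X_comp, C_comp] at this
  linear_combination -this

lemma eval_recurrence (n : ℕ) (x : ℝ) :
    x * (p n).eval x = a (n + 1) * (p (n + 1)).eval x + b n * (p n).eval x +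
      a n * (p (n - 1)).eval x := by
  simpa using congrArg (eval x) (H.recurrence n)

lemma shiftRemainder_recurrence (h s q : ℝ) (n : ℕ) :
    C (a (n + 1)) * shiftRemainder p b h s q (n + 1) =
      (X + C (h - b n)) * shiftRemainder p b h s q n - C (a n) * shiftRemainder p b h s q (n - 1) +
      C (b n * (h * s + h ^ 2 * n + h * b n) + h * (q + h * s * n + h ^ 2 * (n * (n - 1) / 2) +
        h * ∑ k ∈ range n, b k)) * p n +
      C (a n) * ((C (2 * h) * X + C (2 * h * s + h ^ 2 * (2 * n - 1) + h * (b n + b (n - 1)))) *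
        p (n - 1)) := by
  refine Polynomial.funext fun x => ?_
  have h1 := H.eval_recurrence n x
  have h2 := H.eval_recurrence n (x + h)
  have h3 := H.a_zero
  set Q := (quad (s + h * ((n + 1 : ℕ) : ℝ)) (q + h * s * ((n + 1 : ℕ) : ℝ) +
    h ^ 2 * (((n + 1 : ℕ) : ℝ) * (((n + 1 : ℕ) : ℝ) - 1) / 2) +
    h * ∑ k ∈ range (n + 1), b k)).eval x with hQ
  simp only [quad, eval_add, eval_mul, eval_pow, eval_X, eval_C] at hQ
  simp only [shiftRemainder, quad, eval_add, eval_sub, eval_mul, eval_pow, eval_X, eval_C,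
    eval_comp]
  -- For n = 0 the truncated index n - 1 is 0, and `a 0 = 0` removes the spurious terms.
  rcases n with _ | n
  · simp only [h3, zero_mul, sum_range_succ, sum_range_zero, Nat.cast_zero, Nat.cast_one,
      zero_add] at h1 h2 hQ ⊢
    linear_combination Q * h1 - (x ^ 2 + s * x + q) * h2 +
      (a 1 * (p 1).eval x - x * (p 0).eval x + b 0 * (p 0).eval x) * hQ
  · simp only [sum_range_succ, Nat.add_sub_cancel, Nat.cast_add, Nat.cast_one] at h1 h2 hQ ⊢
    linear_combination Q * h1 - (x ^ 2 + s * x + q) * h2 +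
      (a (n + 1 + 1) * (p (n + 1 + 1)).eval x - x * (p (n + 1)).eval x +
        b (n + 1) * (p (n + 1)).eval x + a (n + 1) * (p n).eval x) * hQ

/-- The quadratic multiplier of p_n is tuned to cancel all coefficients of degree at least n. By
induction, every term on the right of `shiftRemainder_recurrence` has degree at most n. -/
lemma degree_shiftRemainder_lt (h s q : ℝ) (n : ℕ) :
    (shiftRemainder p b h s q n).degree < n := by
  induction n using Nat.strong_induction_on with
  | _ n ih =>
  rcases n with _ | n
  · obtain ⟨r, hr⟩ : ∃ r, p 0 = C r := ⟨_, eq_C_of_natDegree_eq_zero (H.natDegree_eq 0)⟩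
    have : shiftRemainder p b h s q 0 = 0 := by
      simp [shiftRemainder, hr]
    simp [this]
  · have ha := H.a_succ_ne_zero n
    have e : shiftRemainder p b h s q (n + 1) =
        C (a (n + 1))⁻¹ * (C (a (n + 1)) * shiftRemainder p b h s q (n + 1)) := by
      rw [← mul_assoc, ← C_mul, inv_mul_cancel₀ ha, C_1, one_mul]
    rw [e]
    refine (degree_C_mul_le_degree _ _).trans_lt ?_
    rw [H.shiftRemainder_recurrence]
    have hcoe : ((n : ℕ) : WithBot ℕ) < ((n + 1 : ℕ) : WithBot ℕ) := by
      exact_mod_cast Nat.lt_succ_self n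
    have hlin (u v : ℝ) : (C u * X + C v : ℝ[X]).degree ≤ 1 := degree_linear_le
    refine (degree_add_le _ _).trans_lt (max_lt ((degree_add_le _ _).trans_lt (max_lt
      ((degree_sub_le _ _).trans_lt (max_lt ?_ ?_)) ?_)) ?_)
    · rw [degree_mul, degree_X_add_C]
      have := ih n (Nat.lt_succ_self n)
      rcases eq_or_ne (shiftRemainder p b h s q n) 0 with h0 | h0
      · rw [h0]; simp
      · rw [degree_eq_natDegree h0] at this ⊢
        have h4 : (shiftRemainder p b h s q n).natDegree < n := by exact_mod_cast this
        exact_mod_cast (show 1 + (shiftRemainder p b h s q n).natDegree < n + 1 by omega)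
    · rcases n with _ | n
      · simp [H.a_zero]
      · refine (degree_C_mul_le_degree _ _).trans_lt ((ih n (by omega)).trans ?_)
        exact_mod_cast (show n < n + 1 + 1 by omega)
    · refine (degree_C_mul_le_degree _ _).trans_lt ?_
      rwa [H.degree_eq]
    · rcases n with _ | n
      · simp [H.a_zero]
      · refine (degree_C_mul_le_degree _ _).trans_lt ?_
        rw [degree_mul, H.degree_eq]
        calc _ ≤ (1 : WithBot ℕ) + (n : ℕ) := by gcongr; exacts [hlin _ _, le_rfl]
          _ < _ := by exact_mod_cast (show 1 + n < n + 1 + 1 by omega)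

end
end IsOrthonormalSystem

/-! ### Moments of shifted products -/

/-- The ladder sequence `x_n` expressed through the recurrence coefficients. -/
noncomputable def ladderX (α β γ c : ℝ) (b : ℕ → ℝ) (n : ℕ) : ℝ :=
  b n - (n + (n + α + β) * c - γ) / (1 - c)

/-- The ladder sequence `y_n` expressed through the recurrence coefficients. -/
noncomputable def ladderY (α β c : ℝ) (a b : ℕ → ℝ) (n : ℕ) : ℝ :=
  (1 - c) / c * a n ^ 2 - n * (α + β) - n * (n - 1) / 2 - ∑ k ∈ range n, b k

/-- Apply the Pearson relation to p_m(x-1) p_n(x): the shift passes from p_m to p_n. -/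
lemma pearson_shift {L : ℝ[X] →ₗ[ℝ] ℝ} {α β γ c : ℝ} (p : ℕ → ℝ[X])
    (hP : ∀ f : ℝ[X], L (quad (γ - 1) 0 * f) =
      c * L (quad (α + β) (α * β) * f.comp (X + C 1))) (m n : ℕ) :
    L (quad (γ - 1) 0 * (p m).comp (X + C (-1)) * p n) =
      c * L (quad (α + β) (α * β) * (p n).comp (X + C 1) * p m) := by
  have e : (((p m).comp (X + C (-1))) * p n).comp (X + C 1) = (p n).comp (X + C 1) * p m := by
    rw [mul_comp, comp_assoc]
    simp [add_assoc, mul_comm]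
  rw [mul_assoc, hP, e, mul_assoc]

namespace IsOrthonormalSystem

variable {L : ℝ[X] →ₗ[ℝ] ℝ} {p : ℕ → ℝ[X]} {a b : ℕ → ℝ} (H : IsOrthonormalSystem L p a b)
include H

lemma map_X_mul_mul (n : ℕ) (f : ℝ[X]) :
    L (X * p n * f) = a (n + 1) * L (p (n + 1) * f) + b n * L (p n * f) +
      a n * L (p (n - 1) * f) := by
  rw [H.recurrence]
  simp only [add_mul, map_add, mul_assoc, map_C_mul]

lemma map_X_mul_self (n : ℕ) : L (X * p n * p n) = b n := by
  rw [H.map_X_mul_mul]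
  simp only [H.orthonormal]
  rcases n with _ | n <;> simp [H.a_zero]

lemma map_X_mul_succ (n : ℕ) : L (X * p n * p (n + 1)) = a (n + 1) := by
  rw [H.map_X_mul_mul]
  simp only [H.orthonormal]
  rcases n with _ | n
  · simp [H.a_zero]
  · simp [show n ≠ n + 1 + 1 by omega]

lemma map_X_sq_mul_self (n : ℕ) :
    L (X ^ 2 * p n * p n) = a (n + 1) ^ 2 + b n ^ 2 + a n ^ 2 := by
  have e : X ^ 2 * p n * p n = X * p n * (X * p n) := by ring
  have e1 : p (n + 1) * (X * p n) = X * p n * p (n + 1) := by ring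
  have e2 : p n * (X * p n) = X * p n * p n := by ring
  rw [e, H.map_X_mul_mul, e1, e2, H.map_X_mul_succ, H.map_X_mul_self]
  rcases n with _ | n
  · simp [H.a_zero]; ring
  · have e3 : p (n + 1 - 1) * (X * p (n + 1)) = X * p n * p (n + 1) := by
      rw [Nat.add_sub_cancel]; ring
    rw [e3, H.map_X_mul_succ]; ring

lemma map_X_sq_mul_succ (n : ℕ) :
    L (X ^ 2 * p n * p (n + 1)) = a (n + 1) * (b n + b (n + 1)) := by
  have e : X ^ 2 * p n * p (n + 1) = X * p n * (X * p (n + 1)) := by ring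
  have e1 : p (n + 1) * (X * p (n + 1)) = X * p (n + 1) * p (n + 1) := by ring
  have e2 : p n * (X * p (n + 1)) = X * p n * p (n + 1) := by ring
  rw [e, H.map_X_mul_mul, e1, e2, H.map_X_mul_self, H.map_X_mul_succ]
  rcases n with _ | n
  · simp [H.a_zero]; ring
  · have e3 : p (n + 1 - 1) * (X * p (n + 1 + 1)) = X * p (n + 1 + 1) * p n := by
      rw [Nat.add_sub_cancel]; ring
    rw [e3, H.map_X_mul_mul]
    simp [H.orthonormal, show n + 1 + 1 + 1 ≠ n by omega, show n + 1 + 1 ≠ n by omega]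
    ring

/-- The remainder has degree below n ≤ m, hence is orthogonal to p_m; only the multiplier of p_n
survives. -/
lemma map_quad_shift_mul {n m : ℕ} (hnm : n ≤ m) (h s q : ℝ) :
    L (quad s q * (p n).comp (X + C h) * p m) =
      L (X ^ 2 * p n * p m) + (s + h * n) * L (X * p n * p m) +
      (q + h * s * n + h ^ 2 * (n * (n - 1) / 2) + h * ∑ k ∈ range n, b k) * L (p n * p m) := by
  have h0 := H.map_mul_eq_zero_of_le hnm (H.degree_shiftRemainder_lt h s q n)
  simp only [shiftRemainder, quad, sub_mul, add_mul, map_sub, map_add, mul_assoc,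
    map_C_mul] at h0 ⊢
  linear_combination h0

lemma map_quad_shift_mul_self (n : ℕ) (h s q : ℝ) :
    L (quad s q * (p n).comp (X + C h) * p n) =
      a (n + 1) ^ 2 + b n ^ 2 + a n ^ 2 + (s + h * n) * b n +
      (q + h * s * n + h ^ 2 * (n * (n - 1) / 2) + h * ∑ k ∈ range n, b k) := by
  rw [H.map_quad_shift_mul le_rfl, H.map_X_sq_mul_self, H.map_X_mul_self, H.orthonormal,
    if_pos rfl, mul_one]

lemma map_quad_shift_mul_succ (n : ℕ) (h s q : ℝ) :
    L (quad s q * (p n).comp (X + C h) * p (n + 1)) =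
      a (n + 1) * (b n + b (n + 1) + s + h * n) := by
  rw [H.map_quad_shift_mul n.le_succ, H.map_X_sq_mul_succ, H.map_X_mul_succ, H.orthonormal,
    if_neg (by omega)]
  ring

lemma map_linear_shift_mul {n m : ℕ} (hnm : n ≤ m) (h s : ℝ) :
    L ((X + C s) * (p n).comp (X + C h) * p m) =
      L (X * p n * p m) + (s + h * n) * L (p n * p m) := by
  -- The quadratic formula is affine in (s, q), so differences of these three instances drop the X²
  -- term.
  have h0 := H.map_quad_shift_mul hnm h 0 0
  have h1 := H.map_quad_shift_mul hnm h 1 0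
  have h2 := H.map_quad_shift_mul hnm h 0 1
  simp only [quad, add_mul, map_add, mul_assoc, map_C_mul] at h0 h1 h2 ⊢
  linear_combination h1 + s * h2 - (1 + s) * h0

lemma map_linear_shift_mul_self (n : ℕ) (h s : ℝ) :
    L ((X + C s) * (p n).comp (X + C h) * p n) = b n + s + h * n := by
  rw [H.map_linear_shift_mul le_rfl, H.map_X_mul_self, H.orthonormal, if_pos rfl]; ring

lemma map_linear_shift_mul_succ (n : ℕ) (h s : ℝ) :
    L ((X + C s) * (p n).comp (X + C h) * p (n + 1)) = a (n + 1) := by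
  rw [H.map_linear_shift_mul n.le_succ, H.map_X_mul_succ, H.orthonormal, if_neg (by omega)]; ring

lemma map_shift_recurrence (h : ℝ) (n : ℕ) (f : ℝ[X]) :
    a (n + 1) * L (f * (p (n + 1)).comp (X + C h)) =
      L (f * X * (p n).comp (X + C h)) + (h - b n) * L (f * (p n).comp (X + C h)) -
        a n * L (f * (p (n - 1)).comp (X + C h)) := by
  simp only [← map_C_mul]
  rw [← map_add, ← map_sub]
  congr 1
  simp only [C_sub]
  linear_combination f * H.comp_recurrence h n

/-- Here the shifted factor has the larger degree, so its remainder need not vanish against p_n. The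
recurrence for p_{n+1}(x+1) first lowers the index. -/
lemma map_linear_shift_succ_mul (n : ℕ) (s : ℝ) :
    a (n + 1) * L ((X + C s) * (p (n + 1)).comp (X + C 1) * p n) =
      a (n + 1) ^ 2 + (n + 1) * s + (n + 1) * n / 2 + ∑ k ∈ range (n + 1), b k := by
  have e : L ((X + C s) * (p (n + 1)).comp (X + C 1) * p n) =
      L ((X + C s) * p n * (p (n + 1)).comp (X + C 1)) := by congr 1; ring
  have e1 : L ((X + C s) * p n * X * (p n).comp (X + C 1)) +
      (1 - b n) * L ((X + C s) * p n * (p n).comp (X + C 1)) =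
      L (quad (s + (1 - b n)) (s * (1 - b n)) * (p n).comp (X + C 1) * p n) := by
    rw [← map_C_mul, ← map_add]
    congr 1
    simp only [quad, C_add, C_mul, C_sub]
    ring
  rw [e, H.map_shift_recurrence, e1, H.map_quad_shift_mul_self, sum_range_succ]
  rcases n with _ | n
  · simp [H.a_zero]; ring
  · have e2 : L ((X + C s) * p (n + 1) * (p (n + 1 - 1)).comp (X + C 1)) =
        L ((X + C s) * (p n).comp (X + C 1) * p (n + 1)) := by
      rw [Nat.add_sub_cancel]; congr 1; ring
    rw [e2, H.map_linear_shift_mul_succ]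
    push_cast
    ring

/-- The left side is what the series for A_n(t)/a_n reduces to, up to the factor 1/((t+α)(t+β)). -/
lemma ladderA_functional {α β γ c : ℝ} (hc : c ≠ 0) (hc1 : 1 - c ≠ 0) (n : ℕ) (t : ℝ) :
    L ((X + C (t + γ)) * (p n).comp (X + C (-1)) * p n) / c -
      L ((X + C (t + α + β)) * (p n).comp (X + C 1) * p n) =
      (1 - c) / c * (t + ladderX α β γ c b n) := by
  rw [H.map_linear_shift_mul_self, H.map_linear_shift_mul_self, ladderX]
  field_simp
  ring

lemma ladderB_functional {α β γ c : ℝ} (hc : c ≠ 0) (n : ℕ) (t : ℝ) :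
    a n * (L ((X + C (t + γ)) * (p (n - 1)).comp (X + C (-1)) * p n) / c -
      L ((X + C (t + α + β)) * (p n).comp (X + C 1) * p (n - 1))) =
      -n * t + ladderY α β c a b n := by
  rcases n with _ | n
  · simp [H.a_zero, ladderY]
  · rw [Nat.add_sub_cancel, H.map_linear_shift_mul_succ, mul_sub, H.map_linear_shift_succ_mul,
      ladderY]
    push_cast
    field_simp
    ring

/-! ### Laguerre–Freud equations -/

section Pearson
variable {α β γ c : ℝ} (hP : ∀ f : ℝ[X], L (quad (γ - 1) 0 * f) =
  c * L (quad (α + β) (α * β) * f.comp (X + C 1)))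
include hP

lemma laguerre_freud_diagonal (n : ℕ) :
    a (n + 1) ^ 2 + b n ^ 2 + a n ^ 2 + (γ - 1 - n) * b n - (γ - 1) * n + n * (n - 1) / 2 -
      ∑ k ∈ range n, b k =
    c * (a (n + 1) ^ 2 + b n ^ 2 + a n ^ 2 + (α + β + n) * b n + α * β + (α + β) * n +
      n * (n - 1) / 2 + ∑ k ∈ range n, b k) := by
  have := pearson_shift p hP n n
  rw [H.map_quad_shift_mul_self, H.map_quad_shift_mul_self] at this
  linear_combination this

/-- Expand L(σ x p_n(x) p_n(x+1)) by the recurrence applied to p_n(x+1) and to p_n(x). The moments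
with the larger index shifted are then replaced through the Pearson relation for neighbouring
indices. -/
lemma laguerre_freud_offdiagonal (n : ℕ) :
    a (n + 1) ^ 2 * (b (n + 1) + b n + γ - 1 - n) +
      c * a n ^ 2 * (b n + b (n - 1) + α + β + n - 1) =
    c * (a (n + 1) ^ 2 * (b (n + 1) + b n + α + β + n) + a (n + 1) ^ 2 + b n ^ 2 + a n ^ 2 +
      (α + β + n) * b n + α * β + (α + β) * n + n * (n - 1) / 2 + ∑ k ∈ range n, b k) +
      a n ^ 2 * (b n + b (n - 1) + γ - n) := by
  set σ := quad (α + β) (α * β)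
  set T := (p n).comp (X + C 1)
  have h1 := H.map_shift_recurrence 1 n (σ * p n)
  have h2 := H.map_X_mul_mul n (σ * T)
  have h3 := H.map_quad_shift_mul_self n 1 (α + β) (α * β)
  have h4 := pearson_shift p hP n (n + 1)
  have h5 := H.map_quad_shift_mul_succ n 1 (α + β) (α * β)
  rw [H.map_quad_shift_mul_succ] at h4
  have e1 : L (σ * p n * X * T) = L (X * p n * (σ * T)) := by congr 1; ring
  have e2 : L (p n * (σ * T)) = L (σ * T * p n) := by congr 1; ring
  have e3 : L (σ * p n * T) = L (σ * T * p n) := by congr 1; ring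
  have e4 : L (p (n + 1) * (σ * T)) = L (σ * T * p (n + 1)) := by congr 1; ring
  have e5 : L (σ * p n * (p (n + 1)).comp (X + C 1)) =
    L (σ * (p (n + 1)).comp (X + C 1) * p n) := by congr 1; ring
  rw [e1, e3, e5] at h1
  rw [e2, e4] at h2
  rw [h5] at h2
  rw [h3] at h1 h2
  rcases n with _ | n
  · simp only [H.a_zero] at h1 h2 ⊢
    linear_combination c * h1 + c * h2 + a 1 * h4
  · have h6 := H.map_quad_shift_mul_succ n 1 (α + β) (α * β)
    have h7 := pearson_shift p hP n (n + 1)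
    rw [H.map_quad_shift_mul_succ] at h7
    have e6 : L (σ * p (n + 1) * (p (n + 1 - 1)).comp (X + C 1)) =
      L (σ * (p n).comp (X + C 1) * p (n + 1)) := by
      rw [Nat.add_sub_cancel]; congr 1; ring
    have e7 : L (p (n + 1 - 1) * (σ * T)) = L (σ * T * p n) := by
      rw [Nat.add_sub_cancel]; congr 1; ring
    rw [e6, h6] at h1
    rw [e7] at h2
    rw [Nat.add_sub_cancel]
    push_cast at *
    linear_combination c * h1 + c * h2 + a (n + 1 + 1) * h4 - a (n + 1) * h7

end Pearson
end IsOrthonormalSystem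

/-! ### Compatibility relations -/

section Compatibility
variable {α β γ c : ℝ} {a b x y : ℕ → ℝ}

lemma sum_recurrence_coeff (hc1 : 1 - c ≠ 0)
    (hb : ∀ n : ℕ, b n = x n + (n + (n + α + β) * c - γ) / (1 - c)) (n : ℕ) :
    ∑ k ∈ range n, b k = ∑ k ∈ range n, x k +
      (n * (n - 1) / 2 * (1 + c) + n * (α + β) * c - n * γ) / (1 - c) := by
  induction n with
  | zero => simp
  | succ n ih => rw [sum_range_succ, sum_range_succ, ih, hb]; push_cast; field_simp; ring

/-- The first compatibility relation of the ladder coefficients. -/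
lemma ladder_compatibility (hc : c ≠ 0) (hc1 : 1 - c ≠ 0)
    (hb : ∀ n : ℕ, b n = x n + (n + (n + α + β) * c - γ) / (1 - c))
    (hsum : ∀ n : ℕ, y n + y (n + 1) = (1 - c) / c * (∑ k ∈ range (n + 1), x k - b n * x n) +
      α * β - γ / c) (n : ℕ) (t : ℝ) :
    (-n * t + y n) + (-(n + 1) * t + y (n + 1)) = (1 - c) / c * (t - b n) * (t + x n) -
      ((t + 1) * (t + γ) / c - (t + α) * (t + β)) +
      (1 - c) / c * ((n + 1) * t + ∑ k ∈ range n, x k + x n) := by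
  set ρ := (1 - c) / c with hρ
  -- The coefficient of t; `hs` supplies the constant term and `hr` that of t².
  have hb' : ρ * (x n - b n) + (α + β) - (γ + 1) / c + ρ * (n + 1) = -(2 * n + 1) := by
    rw [hb, hρ]; field_simp; ring
  have hs := hsum n
  rw [sum_range_succ] at hs
  have hr : ρ = 1 / c - 1 := by rw [hρ]; field_simp
  linear_combination hs - t * hb' - t ^ 2 * hr

/-- The quadratic relation between the ladder coefficients, obtained by summation of the two
compatibility relations. -/
lemma ladder_quadratic (hc : c ≠ 0) (hc1 : 1 - c ≠ 0) (ha0 : a 0 = 0) (hy0 : y 0 = 0)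
    (hb : ∀ n : ℕ, b n = x n + (n + (n + α + β) * c - γ) / (1 - c))
    (hsum : ∀ n : ℕ, y n + y (n + 1) = (1 - c) / c * (∑ k ∈ range (n + 1), x k - b n * x n) +
      α * β - γ / c)
    (hdiff : ∀ n : ℕ, (1 - c) / c * (a (n + 1) ^ 2 - a n ^ 2) =
      y (n + 1) - y n + b n + n + α + β)
    (hdiff' : ∀ n : ℕ, (1 - c) / c * (a (n + 1) ^ 2 * x (n + 1) - a n ^ 2 * x (n - 1)) =
      -b n * y (n + 1) - (1 - b n) * y n + α * β) (n : ℕ) (t : ℝ) :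
    ((1 - c) / c) ^ 2 * a n ^ 2 * (t + x n) * (t + x (n - 1)) =
      (-n * t + y n) ^ 2 + ((t + 1) * (t + γ) / c - (t + α) * (t + β)) * (-n * t + y n) +
      (1 - c) / c * (n * t + ∑ k ∈ range n, x k) * ((t + α) * (t + β) - (-n * t + y n)) := by
  induction n with
  | zero => simp [ha0, hy0]
  | succ n ih =>
    have h1 := ladder_compatibility hc hc1 hb hsum n t
    set ρ := (1 - c) / c with hρ
    set s := ∑ k ∈ range n, x k
    -- The second compatibility relation; `hdiff` and `hdiff'` are its coefficients of t and 1, and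
    -- the t² terms cancel.
    have h2 : ρ * (a (n + 1) ^ 2 * (t + x (n + 1)) - a n ^ 2 * (t + x (n - 1))) =
        (t - b n) * (-(n + 1) * t + y (n + 1)) - (t + 1 - b n) * (-n * t + y n) +
          (t + α) * (t + β) := by
      linear_combination t * hdiff n + hdiff' n
    rw [sum_range_succ, Nat.add_sub_cancel]
    push_cast
    -- Multiplying the second relation by ρ(t+x_n) and the first by B_{n+1} - B_n produces the
    -- increment of the claim from n to n + 1.
    linear_combination ih + ρ * (t + x n) * h2 -
      ((-(n + 1) * t + y (n + 1)) - (-n * t + y n)) * h1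

end Compatibility

/-! ### The discrete system -/

namespace IsOrthonormalSystem

variable {L : ℝ[X] →ₗ[ℝ] ℝ} {p : ℕ → ℝ[X]} {a b : ℕ → ℝ} (H : IsOrthonormalSystem L p a b)
  {α β γ c : ℝ} (hP : ∀ f : ℝ[X], L (quad (γ - 1) 0 * f) =
    c * L (quad (α + β) (α * β) * f.comp (X + C 1)))
  (hc : c ≠ 0) (hc1 : 1 - c ≠ 0) {x y : ℕ → ℝ} (hx : x = ladderX α β γ c b)
  (hy : y = ladderY α β c a b)

section
include hx

omit H in
lemma recurrence_coeff_eq (n : ℕ) : b n = x n + (n + (n + α + β) * c - γ) / (1 - c) := by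
  rw [hx, ladderX]; ring

include hc1 hy

omit H in
lemma recurrence_coeff_sq_eq (n : ℕ) :
    (1 - c) / c * a n ^ 2 =
      y n + (∑ k ∈ Finset.range n, x k) + n * (n + α + β - γ - 1) / (1 - c) := by
  have h := sum_recurrence_coeff hc1 (recurrence_coeff_eq hx) n
  have h2 : y n = (1 - c) / c * a n ^ 2 - n * (α + β) - n * (n - 1) / 2 - ∑ k ∈ range n, b k := by
    rw [hy, ladderY]
  rw [h] at h2
  rw [h2]
  field_simp
  ring

include hc H hP

lemma ladderY_add_succ (m : ℕ) : y m + y (m + 1) =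
    (1 - c) / c * (∑ k ∈ range (m + 1), x k - b m * x m) + α * β - γ / c := by
  have hyn (m : ℕ) : y m = (1 - c) / c * a m ^ 2 - m * (α + β) - m * (m - 1) / 2 -
      ∑ k ∈ range m, b k := by rw [hy, ladderY]
  have hxn (m : ℕ) : x m = b m - (m + (m + α + β) * c - γ) / (1 - c) := by rw [hx, ladderX]
  have h := H.laguerre_freud_diagonal hP m
  have hs := sum_recurrence_coeff hc1 (recurrence_coeff_eq hx) (m + 1)
  have hs' : ∑ k ∈ range (m + 1), x k = ∑ k ∈ range (m + 1), b k -
      (((m + 1 : ℕ) : ℝ) * (((m + 1 : ℕ) : ℝ) - 1) / 2 * (1 + c) +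
        ((m + 1 : ℕ) : ℝ) * (α + β) * c - ((m + 1 : ℕ) : ℝ) * γ) / (1 - c) := by
    linear_combination -hs
  rw [hs', hyn, hyn, hxn, sum_range_succ]
  push_cast
  linear_combination (norm := (field_simp; ring)) (1 / c) * h

lemma ladder_quadratic (n : ℕ) (t : ℝ) :
    ((1 - c) / c) ^ 2 * a n ^ 2 * (t + x n) * (t + x (n - 1)) =
      (-n * t + y n) ^ 2 + ((t + 1) * (t + γ) / c - (t + α) * (t + β)) * (-n * t + y n) +
      (1 - c) / c * (n * t + ∑ k ∈ range n, x k) * ((t + α) * (t + β) - (-n * t + y n)) := by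
  have hb := recurrence_coeff_eq hx
  have hyn (m : ℕ) : y m = (1 - c) / c * a m ^ 2 - m * (α + β) - m * (m - 1) / 2 -
      ∑ k ∈ range m, b k := by rw [hy, ladderY]
  have hxn (m : ℕ) : x m = b m - (m + (m + α + β) * c - γ) / (1 - c) := by rw [hx, ladderX]
  have hdiff (m : ℕ) : (1 - c) / c * (a (m + 1) ^ 2 - a m ^ 2) =
      y (m + 1) - y m + b m + m + α + β := by
    rw [hyn, hyn, sum_range_succ]; push_cast; ring
  refine HypergeometricWeights.ladder_quadratic hc hc1 H.a_zero ?_ hb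
    (H.ladderY_add_succ hP hc hc1 hx hy) hdiff (fun m => ?_) n t
  · simp [hyn, H.a_zero]
  · have h := H.laguerre_freud_offdiagonal hP m
    rcases m with _ | m
    · rw [hyn, hyn, hxn, sum_range_succ]
      simp only [H.a_zero, sum_range_zero] at h ⊢
      push_cast at h ⊢
      linear_combination (norm := (field_simp; ring)) (1 / c) * h
    · rw [hyn, hyn, hxn (m + 1 + 1), hxn (m + 1 - 1), sum_range_succ]
      rw [Nat.add_sub_cancel] at h ⊢
      push_cast at h ⊢
      linear_combination (norm := (field_simp; ring)) (1 / c) * h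

lemma first_discrete_equation (n : ℕ) :
    (y n - α * β + (α + β + n) * x n - x n ^ 2) *
        (y (n + 1) - α * β + (α + β + n + 1) * x n - x n ^ 2) =
      1 / c * ((x n - 1) * (x n - α) * (x n - β) * (x n - γ)) := by
  -- At t = -x_n the left side of the quadratic relation vanishes and the sums in `h0` and `h1`
  -- agree.
  have h0 := H.ladder_quadratic hP hc hc1 hx hy n (-x n)
  have h1 := ladder_compatibility hc hc1 (recurrence_coeff_eq hx)
    (H.ladderY_add_succ hP hc hc1 hx hy) n (-x n)
  linear_combination h0 + (y n - α * β + (α + β + n) * x n - x n ^ 2) * h1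

lemma second_discrete_equation (n : ℕ) :
    (den α β γ n (y n) * x n + num α β γ n (y n)) *
        (den α β γ n (y n) * x (n - 1) + num α β γ n (y n)) = quartic α β γ n (y n) := by
  set X := ∑ k ∈ range n, x k with hX
  set A := (1 - c) / c * a n ^ 2 with hA
  have hXA : X = A - y n - n * (n + α + β - γ - 1) / (1 - c) := by
    rw [hA, recurrence_coeff_sq_eq hc1 hx hy n]; ring
  -- The values at 0, 1, -1 isolate the coefficients of 1 and t; `hXA` eliminates the sum of the
  -- x_k.
  have h0 := H.ladder_quadratic hP hc hc1 hx hy n 0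
  have h1 := H.ladder_quadratic hP hc hc1 hx hy n 1
  have h2 := H.ladder_quadratic hP hc hc1 hx hy n (-1)
  have hD : A * ((1 - c) * (x n + x (n - 1)) - (1 - c) * (α + β + n)) =
      -den α β γ n (y n) := by
    unfold den
    rw [← hX, hXA] at h1 h2
    rw [hA] at *
    linear_combination (norm := (field_simp; ring)) c / 2 * h1 - c / 2 * h2
  have hN : A * ((1 - c) * (x n * x (n - 1)) - (1 - c) * (α * β - y n)) =
      num α β γ n (y n) := by
    unfold num
    rw [← hX, hXA] at h0
    rw [hA] at *
    linear_combination (norm := (field_simp; ring)) c * h0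
  -- Cross-multiplying `hD` and `hN` eliminates A without division, so no exceptional case arises.
  have key : den α β γ n (y n) * (x n * x (n - 1) - (α * β - y n)) +
      num α β γ n (y n) * (x n + x (n - 1) - (α + β + n)) = 0 := by
    rw [← hN]
    linear_combination (x n * x (n - 1) - (α * β - y n)) * hD
  -- The left side is the resultant of N - Dt with q = t² + (α+β+n)t + αβ - y, and the four factors
  -- of `quartic` are -q(-e) for e = α, β, γ, 1.
  have hid : num α β γ n (y n) ^ 2 + den α β γ n (y n) * (den α β γ n (y n) * (α * β - y n) +
      num α β γ n (y n) * (α + β + n)) = quartic α β γ n (y n) := by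
    unfold den num quartic; ring
  linear_combination den α β γ n (y n) * key + hid

end
end IsOrthonormalSystem

/-! ### The hypergeometric weight -/

section Weight

variable {α β γ c : ℝ}

lemma weight_pos (hα : 0 < α) (hβ : 0 < β) (hγ : 0 < γ) (hc : 0 < c) (k : ℕ) :
    0 < weight α β γ c k := by
  have := ascPochhammer_pos k α hα
  have := ascPochhammer_pos k β hβ
  have := ascPochhammer_pos k γ hγ
  unfold weight
  positivity

lemma weight_succ (hγ : 0 < γ) (k : ℕ) :
    ((k : ℝ) + 1) * (γ + k) * weight α β γ c (k + 1) =
      c * (α + k) * (β + k) * weight α β γ c k := by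
  have h := (ascPochhammer_pos k γ hγ).ne'
  have h2 : γ + k ≠ 0 := by positivity
  have h3 : (k.factorial : ℝ) ≠ 0 := by positivity
  have h4 : (k : ℝ) + 1 ≠ 0 := by positivity
  simp only [weight, ascPochhammer_succ_eval, Nat.factorial_succ, Nat.cast_mul, Nat.cast_add,
    Nat.cast_one, pow_succ]
  field_simp

lemma succ_mul_weight_succ (hγ : 0 < γ) (k : ℕ) :
    ((k : ℝ) + 1) * weight α β γ c (k + 1) =
      c * α * β / γ * weight (α + 1) (β + 1) (γ + 1) c k := by
  have h := (ascPochhammer_pos k (γ + 1) (by linarith)).ne'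
  have h3 : (k.factorial : ℝ) ≠ 0 := by positivity
  have h4 : (k : ℝ) + 1 ≠ 0 := by positivity
  have e (z : ℝ) : (ascPochhammer ℝ (k + 1)).eval z = z * (ascPochhammer ℝ k).eval (z + 1) := by
    simp [ascPochhammer_succ_left]
  simp only [weight, e, Nat.factorial_succ, Nat.cast_mul, Nat.cast_add, Nat.cast_one, pow_succ]
  field_simp

open Filter Topology in
lemma summable_pow_mul_weight (hα : 0 < α) (hβ : 0 < β) (hγ : 0 < γ) (hc : 0 < c) (hc1 : c < 1)
    (j : ℕ) : Summable fun k : ℕ => ((k : ℝ) + 1) ^ j * weight α β γ c k := by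
  have hw := weight_pos hα hβ hγ hc
  refine summable_of_ratio_test_tendsto_lt_one hc1 (Eventually.of_forall fun k => ?_) ?_
  · have := hw k
    positivity
  have hlim (u v : ℝ) : Tendsto (fun k : ℕ => ((k : ℝ) + u) / (k + v)) atTop (𝓝 1) := by
    simpa [add_comm] using tendsto_add_mul_div_add_mul_atTop_nhds u v 1 one_ne_zero
  have h : Tendsto (fun k : ℕ => (((k : ℝ) + 2) / (k + 1)) ^ j *
      (c * (((k : ℝ) + α) / (k + γ)) * (((k : ℝ) + β) / (k + 1)))) atTop
      (𝓝 (1 ^ j * (c * 1 * 1))) :=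
    ((hlim 2 1).pow j).mul (((hlim α γ).const_mul c).mul (hlim β 1))
  simp only [one_pow, one_mul, mul_one] at h
  refine h.congr fun k => ?_
  have h1 := hw k
  have h2 := hw (k + 1)
  have h3 := weight_succ (α := α) (β := β) (c := c) hγ k
  rw [Real.norm_of_nonneg (by positivity), Real.norm_of_nonneg (by positivity)]
  have h4 : weight α β γ c (k + 1) =
      c * (α + k) * (β + k) * weight α β γ c k / (((k : ℝ) + 1) * (γ + k)) := by
    rw [← h3]; field_simp
  rw [h4]
  push_cast
  rw [add_assoc (k : ℝ) 1 1, one_add_one_eq_two, div_pow]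
  field_simp
  ring

lemma summable_eval_mul_weight (hα : 0 < α) (hβ : 0 < β) (hγ : 0 < γ) (hc : 0 < c) (hc1 : c < 1)
    (f : ℝ[X]) : Summable fun k : ℕ => f.eval (k : ℝ) * weight α β γ c k := by
  induction f using Polynomial.induction_on' with
  | add f g hf hg => simpa only [eval_add, add_mul] using hf.add hg
  | monomial j r =>
    simp only [eval_monomial, mul_assoc]
    refine Summable.mul_left _ (Summable.of_nonneg_of_le (fun k => ?_) (fun k => ?_)
      (summable_pow_mul_weight hα hβ hγ hc hc1 j))
    · have := weight_pos hα hβ hγ hc k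
      positivity
    · have := weight_pos hα hβ hγ hc k
      gcongr
      linarith

lemma tsum_weight : ∑' k, weight α β γ c k = ordinaryHypergeometric α β γ c := by
  rw [ordinaryHypergeometric_eq_tsum]
  refine tsum_congr fun k => ?_
  rw [weight, smul_eq_mul]
  field_simp

lemma kernel_zero_mul {t : ℝ} (hc : c ≠ 0) (h1 : t + α ≠ 0) (h2 : t + β ≠ 0) (h : t + 1 ≠ 0)
    (w : ℝ) :
    kernel α β γ c t 0 * w = (t + γ) / c * w / ((t + α) * (t + β)) := by
  have h1' : α + (t + 1) - 1 ≠ 0 := by rwa [show α + (t + 1) - 1 = t + α by ring]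
  have h2' : β + (t + 1) - 1 ≠ 0 := by rwa [show β + (t + 1) - 1 = t + β by ring]
  simp only [kernel, potential, Nat.cast_zero, mul_zero, zero_div, add_zero, sub_zero]
  field_simp
  ring

/-- The difference of potentials is divisible by t - k, and `weight_succ` absorbs the remaining
denominator (α+k)(β+k) into the weight at k. -/
lemma kernel_succ_mul_weight {t : ℝ} (hα : 0 < α) (hβ : 0 < β) (hγ : 0 < γ) (hc : 0 < c)
    (h1 : t + α ≠ 0) (h2 : t + β ≠ 0) (k : ℕ) (h : t + 1 ≠ (k + 1 : ℕ)) :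
    kernel α β γ c t (k + 1) * weight α β γ c (k + 1) =
      ((t + (k + 1 : ℕ) + γ) / c * weight α β γ c (k + 1) - (t + k + α + β) * weight α β γ c k) /
        ((t + α) * (t + β)) := by
  have h1' : α + (t + 1) - 1 ≠ 0 := by rwa [show α + (t + 1) - 1 = t + α by ring]
  have h2' : β + (t + 1) - 1 ≠ 0 := by rwa [show β + (t + 1) - 1 = t + β by ring]
  push_cast at h
  have h3 : t + 1 - ((k : ℝ) + 1) ≠ 0 := sub_ne_zero.mpr h
  have h3' : t - k ≠ 0 := by rwa [show t - (k : ℝ) = t + 1 - (k + 1) by ring]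
  have h4 : α + k ≠ 0 := by positivity
  have h5 : β + k ≠ 0 := by positivity
  have hw : weight α β γ c k = ((k : ℝ) + 1) * (γ + k) * weight α β γ c (k + 1) /
      (c * (α + k) * (β + k)) := by
    rw [weight_succ hγ]; field_simp
  rw [hw]
  simp only [kernel, potential]
  push_cast
  rw [show α + ((k : ℝ) + 1) - 1 = α + k by ring, show β + ((k : ℝ) + 1) - 1 = β + k by ring,
    show α + (t + 1) - 1 = t + α by ring, show β + (t + 1) - 1 = t + β by ring,
    show t + 1 - ((k : ℝ) + 1) = t - k by ring]
  field_simp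
  ring

end Weight

/-! ### The functional and the ladder series -/

/-- The linear functional `f ↦ ∑ k, f(k) w_k` on polynomials. -/
noncomputable def weightFunctional (w : ℕ → ℝ)
    (hw : ∀ f : ℝ[X], Summable fun k : ℕ => f.eval (k : ℝ) * w k) : ℝ[X] →ₗ[ℝ] ℝ where
  toFun f := ∑' k : ℕ, f.eval (k : ℝ) * w k
  map_add' f g := by
    simp only [eval_add, add_mul]
    exact (hw f).tsum_add (hw g)
  map_smul' r f := by
    simp only [eval_smul, smul_eq_mul, mul_assoc, tsum_mul_left, RingHom.id_apply]

section Functional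

variable {w : ℕ → ℝ} {hw : ∀ f : ℝ[X], Summable fun k : ℕ => f.eval (k : ℝ) * w k}

lemma hasSum_weightFunctional (f : ℝ[X]) :
    HasSum (fun k : ℕ => f.eval (k : ℝ) * w k) (weightFunctional w hw f) :=
  (hw f).hasSum

lemma weightFunctional_mul_self_pos (hpos : ∀ k, 0 < w k) {f : ℝ[X]} (hf : f ≠ 0) :
    0 < weightFunctional w hw (f * f) := by
  obtain ⟨k, hk⟩ : ∃ k : ℕ, f.eval (k : ℝ) ≠ 0 := by
    by_contra! h
    refine hf (eq_zero_of_infinite_isRoot f ?_)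
    refine (Set.infinite_range_of_injective (Nat.cast_injective (R := ℝ))).mono ?_
    rintro _ ⟨k, rfl⟩
    exact h k
  refine (hw (f * f)).tsum_pos (fun j => ?_) k ?_
  · rw [eval_mul]
    exact mul_nonneg (mul_self_nonneg _) (hpos j).le
  · rw [eval_mul]
    exact mul_pos (mul_self_pos.mpr hk) (hpos k)

/-- Orthonormality for the weights and recurrence relation as a statement about the functional. -/
lemma isOrthonormalSystem_weightFunctional {p : ℕ → ℝ[X]} {a b : ℕ → ℝ}
    (hp : IsOrthonormalPolynomials w p) (hab : IsRecurrenceCoefficients p a b) :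
    IsOrthonormalSystem (weightFunctional w hw) p a b where
  natDegree_eq := hp.natDegree_eq
  ne_zero n := leadingCoeff_ne_zero.mp (hp.leadingCoeff_pos n).ne'
  orthonormal m n := by
    have h := hp.orthonormal m n
    simp only [← eval_mul] at h
    exact (hasSum_weightFunctional _).unique h
  a_zero := hab.a_zero
  recurrence := hab.recurrence

end Functional

section Ladder

variable {α β γ c : ℝ}
  {hw : ∀ f : ℝ[X], Summable fun k : ℕ => f.eval (k : ℝ) * weight α β γ c k}

/-- The factor X(X+γ-1) vanishes at 0, so shifting the summation index leaves no boundary term. -/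
lemma weightFunctional_pearson (hγ : 0 < γ) (f : ℝ[X]) :
    weightFunctional (weight α β γ c) hw (quad (γ - 1) 0 * f) =
      c * weightFunctional (weight α β γ c) hw
        (quad (α + β) (α * β) * f.comp (X + C 1)) := by
  have h1 := hasSum_weightFunctional (hw := hw) (quad (γ - 1) 0 * f)
  have h2 := (hasSum_weightFunctional (hw := hw)
    (quad (α + β) (α * β) * f.comp (X + C 1))).mul_left c
  rw [← hasSum_nat_add_iff' 1] at h1
  have h3 : (quad (γ - 1) 0 * f).eval ((0 : ℕ) : ℝ) = 0 := by simp [quad]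
  rw [sum_range_one, h3, zero_mul, sub_zero] at h1
  refine h1.unique (h2.congr_fun fun k => ?_)
  simp only [quad, eval_mul, eval_add, eval_pow, eval_X, eval_C, eval_comp]
  push_cast
  linear_combination f.eval ((k : ℝ) + 1) * weight_succ (α := α) (β := β) (c := c) hγ k

lemma hasSum_kernel (hα : 0 < α) (hβ : 0 < β) (hγ : 0 < γ) (hc : 0 < c) {t : ℝ}
    (h1 : t ≠ -α) (h2 : t ≠ -β) (h : ∀ k : ℕ, t + 1 ≠ k) (f : ℝ[X]) :
    HasSum (fun k : ℕ => f.eval (k : ℝ) * kernel α β γ c t k * weight α β γ c k)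
      ((weightFunctional (weight α β γ c) hw ((X + C (t + γ)) * f) / c -
        weightFunctional (weight α β γ c) hw ((X + C (t + α + β)) * f.comp (X + C 1))) /
          ((t + α) * (t + β))) := by
  have h1' : t + α ≠ 0 := fun h => h1 (by linarith)
  have h2' : t + β ≠ 0 := fun h => h2 (by linarith)
  have e1 := ((hasSum_weightFunctional (hw := hw) ((X + C (t + γ)) * f)).div_const c)
  have e2 := hasSum_weightFunctional (hw := hw) ((X + C (t + α + β)) * f.comp (X + C 1))
  -- The kernel at k + 1 involves the weight at k, so the term k = 0 is split off from the unshifted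
  -- series only.
  rw [← hasSum_nat_add_iff' 1] at e1 ⊢
  have e3 := (e1.sub e2).div_const ((t + α) * (t + β))
  have h0 : t + 1 ≠ 0 := by simpa using h 0
  rw [sum_range_one, mul_assoc, kernel_zero_mul hc.ne' h1' h2' h0]
  rw [sum_range_one] at e3
  have e4 : (weightFunctional (weight α β γ c) hw ((X + C (t + γ)) * f) / c -
        weightFunctional (weight α β γ c) hw ((X + C (t + α + β)) * f.comp (X + C 1))) /
          ((t + α) * (t + β)) -
        f.eval ((0 : ℕ) : ℝ) * ((t + γ) / c * weight α β γ c 0 / ((t + α) * (t + β))) =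
      (weightFunctional (weight α β γ c) hw ((X + C (t + γ)) * f) / c -
        ((X + C (t + γ)) * f).eval ((0 : ℕ) : ℝ) * weight α β γ c 0 / c -
        weightFunctional (weight α β γ c) hw ((X + C (t + α + β)) * f.comp (X + C 1))) /
          ((t + α) * (t + β)) := by
    simp only [eval_mul, eval_add, eval_X, eval_C]
    push_cast
    ring
  rw [e4]
  refine e3.congr_fun fun k => ?_
  rw [mul_assoc, kernel_succ_mul_weight hα hβ hγ hc h1' h2' k (h (k + 1))]
  simp only [eval_mul, eval_add, eval_X, eval_C, eval_comp]
  push_cast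
  ring

end Ladder

/-! ### Existence of orthonormal polynomials -/

/-- The monic orthogonal polynomials of the functional `L`, together with their predecessors,
built by the three-term recurrence. -/
noncomputable def monicOrthogonalPair (L : ℝ[X] →ₗ[ℝ] ℝ) : ℕ → ℝ[X] × ℝ[X] × ℝ
  | 0 => (1, 0, 0)
  | n + 1 =>
    let P := (monicOrthogonalPair L n).1
    let P' := (monicOrthogonalPair L n).2.1
    let r := (monicOrthogonalPair L n).2.2
    let Q := (X - C (L (X * P * P) / L (P * P))) * P - C r * P'
    (Q, P, L (Q * Q) / L (P * P))

/-- The monic orthogonal polynomials of the functional `L`. -/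
noncomputable def monicOrthogonal (L : ℝ[X] →ₗ[ℝ] ℝ) (n : ℕ) : ℝ[X] := (monicOrthogonalPair L n).1

/-- The coefficient of `P_{n-1}` in the recurrence of the monic orthogonal polynomials. -/
noncomputable def monicOrthogonalRatio (L : ℝ[X] →ₗ[ℝ] ℝ) (n : ℕ) : ℝ :=
  (monicOrthogonalPair L n).2.2

section
variable (L : ℝ[X] →ₗ[ℝ] ℝ)

/-- The coefficient of `P_n` in the recurrence of the monic orthogonal polynomials. -/
noncomputable def monicOrthogonalDiag (n : ℕ) : ℝ :=
  L (X * monicOrthogonal L n * monicOrthogonal L n) / L (monicOrthogonal L n * monicOrthogonal L n)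

lemma monicOrthogonal_zero : monicOrthogonal L 0 = 1 := rfl

lemma monicOrthogonalRatio_zero : monicOrthogonalRatio L 0 = 0 := rfl

lemma monicOrthogonalRatio_succ (n : ℕ) : monicOrthogonalRatio L (n + 1) =
    L (monicOrthogonal L (n + 1) * monicOrthogonal L (n + 1)) /
      L (monicOrthogonal L n * monicOrthogonal L n) := rfl

lemma X_mul_monicOrthogonal (n : ℕ) : X * monicOrthogonal L n = monicOrthogonal L (n + 1) +
    C (monicOrthogonalDiag L n) * monicOrthogonal L n +
      C (monicOrthogonalRatio L n) * monicOrthogonal L (n - 1) := by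
  have h : monicOrthogonal L (n + 1) = (X - C (monicOrthogonalDiag L n)) * monicOrthogonal L n -
      C (monicOrthogonalRatio L n) * (monicOrthogonalPair L n).2.1 := rfl
  rw [h]
  rcases n with _ | n
  · rw [monicOrthogonalRatio_zero]; simp only [C_0]; ring
  · have h2 : (monicOrthogonalPair L (n + 1)).2.1 = monicOrthogonal L n := rfl
    rw [h2, Nat.add_sub_cancel]; ring

lemma monic_natDegree_monicOrthogonal (n : ℕ) :
    (monicOrthogonal L n).Monic ∧ (monicOrthogonal L n).natDegree = n := by
  induction n using Nat.strong_induction_on with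
  | _ n ih =>
  rcases n with _ | n
  · simp [monicOrthogonal_zero]
  · have h := X_mul_monicOrthogonal L n
    have h' : monicOrthogonal L (n + 1) = X * monicOrthogonal L n -
        (C (monicOrthogonalDiag L n) * monicOrthogonal L n +
          C (monicOrthogonalRatio L n) * monicOrthogonal L (n - 1)) := by rw [h]; ring
    obtain ⟨hm, hd⟩ := ih n n.lt_succ_self
    obtain ⟨hm', hd'⟩ := ih (n - 1) (by omega)
    have hX : (X * monicOrthogonal L n).Monic := monic_X.mul hm
    have hXd : (X * monicOrthogonal L n).degree = ((n + 1 : ℕ) : WithBot ℕ) := by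
      rw [degree_mul, degree_X, degree_eq_natDegree hm.ne_zero, hd]; push_cast; ring
    have hlt : (C (monicOrthogonalDiag L n) * monicOrthogonal L n +
          C (monicOrthogonalRatio L n) * monicOrthogonal L (n - 1)).degree <
        (X * monicOrthogonal L n).degree := by
      rw [hXd]
      refine (degree_add_le _ _).trans_lt (max_lt ?_ ?_)
      · refine (degree_C_mul_le_degree _ _).trans_lt ?_
        rw [degree_eq_natDegree hm.ne_zero, hd]
        exact_mod_cast n.lt_succ_self
      · refine (degree_C_mul_le_degree _ _).trans_lt ?_
        rw [degree_eq_natDegree hm'.ne_zero, hd']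
        exact_mod_cast (show n - 1 < n + 1 by omega)
    rw [h']
    refine ⟨hX.sub_of_left hlt, ?_⟩
    apply natDegree_eq_of_degree_eq_some
    rw [degree_sub_eq_left_of_degree_lt hlt, hXd]

variable {L} (hL : ∀ f : ℝ[X], f ≠ 0 → 0 < L (f * f))
include hL

lemma monicOrthogonal_norm_pos (n : ℕ) : 0 < L (monicOrthogonal L n * monicOrthogonal L n) :=
  hL _ (monic_natDegree_monicOrthogonal L n).1.ne_zero

lemma monicOrthogonal_orthogonal (n : ℕ) :
    ∀ m < n, L (monicOrthogonal L m * monicOrthogonal L n) = 0 := by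
  induction n using Nat.strong_induction_on with
  | _ n ih =>
  rcases n with _ | n
  · simp
  intro m hm
  have ih' (i j : ℕ) (hi : i ≤ n) (hj : j ≤ n) (hij : i ≠ j) :
      L (monicOrthogonal L i * monicOrthogonal L j) = 0 := by
    rcases lt_or_gt_of_ne hij with h | h
    · exact ih j (by omega) i h
    · rw [mul_comm]; exact ih i (by omega) j h
  have hn := (monicOrthogonal_norm_pos hL n).ne'
  have e : L (monicOrthogonal L m * monicOrthogonal L (n + 1)) =
      L (X * monicOrthogonal L m * monicOrthogonal L n) -
        monicOrthogonalDiag L n * L (monicOrthogonal L m * monicOrthogonal L n) -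
        monicOrthogonalRatio L n * L (monicOrthogonal L m * monicOrthogonal L (n - 1)) := by
    rw [← map_C_mul, ← map_C_mul, ← map_sub, ← map_sub]
    congr 1
    linear_combination -monicOrthogonal L m * X_mul_monicOrthogonal L n
  rw [e]
  -- For m = n the diagonal coefficient gives the cancellation, for m = n - 1 the ratio of norms
  -- does; for smaller m every term vanishes.
  rcases (Nat.lt_succ_iff.mp hm).eq_or_lt with rfl | hlt
  · have hz : monicOrthogonalRatio L m * L (monicOrthogonal L m * monicOrthogonal L (m - 1)) = 0 := by
      rcases m with _ | m
      · rw [monicOrthogonalRatio_zero, zero_mul]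
      · rw [ih' _ _ le_rfl (by omega) (by omega), mul_zero]
    rw [hz, monicOrthogonalDiag, div_mul_cancel₀ _ hn]
    ring
  · obtain ⟨k, rfl⟩ : ∃ k, n = k + 1 := ⟨n - 1, by omega⟩
    have h0 : monicOrthogonalRatio L m * L (monicOrthogonal L (m - 1) * monicOrthogonal L (k + 1)) =
        0 := by rw [ih' _ _ (by omega) le_rfl (by omega), mul_zero]
    rw [X_mul_monicOrthogonal, add_mul, add_mul, map_add, map_add, mul_assoc, mul_assoc,
      map_C_mul, map_C_mul, h0, ih' m (k + 1) (by omega) le_rfl (by omega), Nat.add_sub_cancel]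
    rcases eq_or_ne m k with rfl | hmk
    · rw [monicOrthogonalRatio_succ, div_mul_cancel₀ _ (monicOrthogonal_norm_pos hL m).ne']; ring
    · rw [ih' _ _ (by omega) le_rfl (by omega), ih' _ _ (by omega) (by omega) hmk]; ring

/-- A positive definite functional has orthonormal polynomials with positive leading coefficients,
and these satisfy a three-term recurrence. -/
lemma exists_isOrthonormalSystem : ∃ (p : ℕ → ℝ[X]) (a b : ℕ → ℝ),
    IsOrthonormalSystem L p a b ∧ ∀ n, 0 < (p n).leadingCoeff := by
  set P := monicOrthogonal L with hPdef
  set h : ℕ → ℝ := fun n => √(L (P n * P n)) with hh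
  have hpos (n : ℕ) : 0 < h n := Real.sqrt_pos.mpr (monicOrthogonal_norm_pos hL n)
  have hsq (n : ℕ) : h n * h n = L (P n * P n) :=
    Real.mul_self_sqrt (monicOrthogonal_norm_pos hL n).le
  have hne (n : ℕ) : h n ≠ 0 := (hpos n).ne'
  refine ⟨fun n => C (h n)⁻¹ * P n, fun n => if n = 0 then 0 else h n / h (n - 1),
    monicOrthogonalDiag L, ⟨fun n => ?_, fun n => ?_, fun m n => ?_, rfl, fun n => ?_⟩,
    fun n => ?_⟩
  · rw [natDegree_C_mul (inv_ne_zero (hne n)), (monic_natDegree_monicOrthogonal L n).2]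
  · exact mul_ne_zero (C_ne_zero.mpr (inv_ne_zero (hne n)))
      (monic_natDegree_monicOrthogonal L n).1.ne_zero
  · have e : C (h m)⁻¹ * P m * (C (h n)⁻¹ * P n) = C ((h m)⁻¹ * (h n)⁻¹) * (P m * P n) := by
      rw [C_mul]; ring
    rw [e, map_C_mul]
    split_ifs with hmn
    · subst hmn
      rw [← hsq]
      have := hne m
      field_simp
    · rcases lt_or_gt_of_ne hmn with hlt | hlt
      · rw [monicOrthogonal_orthogonal hL n m hlt, mul_zero]
      · rw [mul_comm (P m), monicOrthogonal_orthogonal hL m n hlt, mul_zero]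
  · have hr := X_mul_monicOrthogonal L n
    rw [if_neg n.succ_ne_zero, Nat.add_sub_cancel]
    have e1 : C (h (n + 1) / h n) * (C (h (n + 1))⁻¹ * P (n + 1)) = C (h n)⁻¹ * P (n + 1) := by
      rw [← mul_assoc, ← C_mul]
      congr 2
      have := hne (n + 1)
      field_simp
    have e2 : C (if n = 0 then 0 else h n / h (n - 1)) * (C (h (n - 1))⁻¹ * P (n - 1)) =
        C (h n)⁻¹ * (C (monicOrthogonalRatio L n) * P (n - 1)) := by
      rw [← mul_assoc, ← mul_assoc, ← C_mul, ← C_mul]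
      congr 2
      rcases n with _ | n
      · simp [monicOrthogonalRatio_zero]
      · rw [if_neg n.succ_ne_zero, Nat.add_sub_cancel, monicOrthogonalRatio_succ, ← hPdef, ← hsq,
          ← hsq]
        have := hne n
        have := hne (n + 1)
        field_simp
    rw [e1, e2]
    linear_combination C (h n)⁻¹ * hr
  · rw [leadingCoeff_C_mul_of_isUnit (inv_ne_zero (hne n)).isUnit,
      (monic_natDegree_monicOrthogonal L n).1.leadingCoeff, mul_one]
    exact inv_pos.mpr (hpos n)

end

/-! ### Initial values and uniqueness of the ladder sequences -/

section
variable {α β γ c : ℝ} (hα : 0 < α) (hβ : 0 < β) (hγ : 0 < γ) (hc0 : 0 < c) (hc1 : c < 1)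
  {hw : ∀ f : ℝ[X], Summable fun k : ℕ => f.eval (k : ℝ) * weight α β γ c k}
  {p : ℕ → ℝ[X]} {a b : ℕ → ℝ}
  (H : IsOrthonormalSystem (weightFunctional (weight α β γ c) hw) p a b)

lemma weightFunctional_one :
    weightFunctional (weight α β γ c) hw 1 = ordinaryHypergeometric α β γ c := by
  rw [← tsum_weight]
  simp [weightFunctional]

include hγ in
lemma weightFunctional_X : weightFunctional (weight α β γ c) hw X =
    c * α * β / γ * ordinaryHypergeometric (α + 1) (β + 1) (γ + 1) c := by
  have h := hasSum_weightFunctional (hw := hw) X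
  rw [← hasSum_nat_add_iff' 1] at h
  simp only [sum_range_one, eval_X, Nat.cast_zero, zero_mul, sub_zero, Nat.cast_add, Nat.cast_one,
    succ_mul_weight_succ hγ] at h
  rw [← h.tsum_eq, tsum_mul_left, tsum_weight]

include H hγ in
-- As p_0 is constant, b_0 = L(X)/L(1), a ratio of hypergeometric sums.
lemma recurrence_coeff_zero : b 0 = c * α * β / γ *
    (ordinaryHypergeometric (α + 1) (β + 1) (γ + 1) c / ordinaryHypergeometric α β γ c) := by
  have h0 := H.orthonormal 0 0
  have h1 := H.map_X_mul_self 0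
  obtain ⟨r, hr⟩ : ∃ r, p 0 = C r := ⟨_, eq_C_of_natDegree_eq_zero (H.natDegree_eq 0)⟩
  have e0 : C r * C r = C (r * r) * (1 : ℝ[X]) := by rw [C_mul, mul_one]
  have e1 : X * C r * C r = C (r * r) * (X : ℝ[X]) := by rw [C_mul]; ring
  rw [hr, e0, map_C_mul, weightFunctional_one, if_pos rfl] at h0
  rw [hr, e1, map_C_mul, weightFunctional_X hγ] at h1
  have hF : ordinaryHypergeometric α β γ c ≠ 0 := by
    intro h; rw [h, mul_zero] at h0; exact zero_ne_one h0
  rw [← h1, eq_div_of_mul_eq hF h0]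
  ring

include hα hβ hγ hc0 hc1 H

lemma isLadderSequences :
    IsLadderSequences α β γ c p a (ladderX α β γ c b) (ladderY α β c a b) where
  ladderA n t h1 h2 h := by
    have hs := hasSum_kernel (hw := hw) hα hβ hγ hc0 h1 h2 h (p n * (p n).comp (X + C (-1)))
    have hA := H.ladderA_functional (α := α) (β := β) (γ := γ) hc0.ne' (sub_pos.mpr hc1).ne' n t
    have e1 : (X + C (t + γ)) * (p n * (p n).comp (X + C (-1))) =
        (X + C (t + γ)) * (p n).comp (X + C (-1)) * p n := by ring
    have e2 : (X + C (t + α + β)) * (p n * (p n).comp (X + C (-1))).comp (X + C 1) =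
        (X + C (t + α + β)) * (p n).comp (X + C 1) * p n := by
      rw [mul_comp, comp_assoc]; simp [add_assoc, mul_assoc]
    rw [e1, e2, hA, mul_div_assoc] at hs
    refine hs.congr_fun fun k => ?_
    simp [ladderATerm, sub_eq_add_neg]
  ladderB n t h1 h2 h := by
    have hs := (hasSum_kernel (hw := hw) hα hβ hγ hc0 h1 h2 h
      (p n * (p (n - 1)).comp (X + C (-1)))).mul_left (a n)
    have hB := H.ladderB_functional (α := α) (β := β) (γ := γ) hc0.ne' n t
    have e1 : (X + C (t + γ)) * (p n * (p (n - 1)).comp (X + C (-1))) =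
        (X + C (t + γ)) * (p (n - 1)).comp (X + C (-1)) * p n := by ring
    have e2 : (X + C (t + α + β)) * (p n * (p (n - 1)).comp (X + C (-1))).comp (X + C 1) =
        (X + C (t + α + β)) * (p n).comp (X + C 1) * p (n - 1) := by
      rw [mul_comp, comp_assoc]; simp [add_assoc, mul_assoc]
    rw [e1, e2, ← mul_div_assoc, hB] at hs
    refine hs.congr_fun fun k => ?_
    simp [ladderBTerm, sub_eq_add_neg]

lemma IsLadderSequences.eq_ladder {x y : ℕ → ℝ} (h : IsLadderSequences α β γ c p a x y) :
    x = ladderX α β γ c b ∧ y = ladderY α β c a b := by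
  have h' := isLadderSequences hα hβ hγ hc0 hc1 H
  -- One admissible point determines x_n and y_n; t = 1/2 serves because 3/2 is not a natural number
  -- and α, β > 0.
  have ht : ∀ k : ℕ, (1 / 2 : ℝ) + 1 ≠ k := by
    intro k hk
    have h3 : (3 : ℝ) = (2 * k : ℕ) := by push_cast; linarith
    have h4 : 3 = 2 * k := by exact_mod_cast h3
    omega
  have h1 : (1 / 2 : ℝ) ≠ -α := by linarith
  have h2 : (1 / 2 : ℝ) ≠ -β := by linarith
  have hd : ((1 / 2 : ℝ) + α) * (1 / 2 + β) ≠ 0 := by positivity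
  have hρ : (1 - c) / c ≠ 0 := (div_pos (sub_pos.mpr hc1) hc0).ne'
  constructor <;> funext n
  · have e := (h.ladderA n _ h1 h2 ht).unique (h'.ladderA n _ h1 h2 ht)
    exact add_left_cancel ((div_left_inj' hd).mp (mul_left_cancel₀ hρ e))
  · have e := (h.ladderB n _ h1 h2 ht).unique (h'.ladderB n _ h1 h2 ht)
    exact add_left_cancel ((div_left_inj' hd).mp e)

end
end HypergeometricWeights

theorem theorem1 (α β γ c : ℝ) (hα : 0 < α) (hβ : 0 < β) (hγ : 0 < γ) (hc0 : 0 < c) (hc1 : c < 1) :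
    -- the objects exist
    (∃ (p : ℕ → Polynomial ℝ) (a b x y : ℕ → ℝ),
      HypergeometricWeights.IsOrthonormalPolynomials
        (HypergeometricWeights.weight α β γ c) p ∧
      HypergeometricWeights.IsRecurrenceCoefficients p a b ∧
      HypergeometricWeights.IsLadderSequences α β γ c p a x y) ∧
    ∀ (p : ℕ → Polynomial ℝ) (a b x y : ℕ → ℝ),
      HypergeometricWeights.IsOrthonormalPolynomials
        (HypergeometricWeights.weight α β γ c) p →
      HypergeometricWeights.IsRecurrenceCoefficients p a b →
      HypergeometricWeights.IsLadderSequences α β γ c p a x y →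
      -- first equation of the system
      (∀ n : ℕ,
        (y n - α * β + (α + β + n) * x n - x n ^ 2) *
            (y (n + 1) - α * β + (α + β + n + 1) * x n - x n ^ 2) =
          1 / c * ((x n - 1) * (x n - α) * (x n - β) * (x n - γ))) ∧
      -- second equation of the system, wherever its denominator does not vanish
      (∀ n : ℕ, 1 ≤ n → HypergeometricWeights.den α β γ n (y n) ≠ 0 →
        (x n + HypergeometricWeights.num α β γ n (y n) /
            HypergeometricWeights.den α β γ n (y n)) *
          (x (n - 1) + HypergeometricWeights.num α β γ n (y n) /
            HypergeometricWeights.den α β γ n (y n)) =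
          HypergeometricWeights.quartic α β γ n (y n) /
            HypergeometricWeights.den α β γ n (y n) ^ 2) ∧
      -- second equation multiplied by the square of its denominator, without exception
      (∀ n : ℕ, 1 ≤ n →
        (HypergeometricWeights.den α β γ n (y n) * x n +
            HypergeometricWeights.num α β γ n (y n)) *
          (HypergeometricWeights.den α β γ n (y n) * x (n - 1) +
            HypergeometricWeights.num α β γ n (y n)) =
          HypergeometricWeights.quartic α β γ n (y n)) ∧
      -- initial values
      y 0 = 0 ∧
      x 0 = c * α * β / γ *
          (ordinaryHypergeometric (α + 1) (β + 1) (γ + 1) c / ordinaryHypergeometric α β γ c) -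
        ((α + β) * c - γ) / (1 - c) ∧
      -- recurrence coefficients
      (∀ n : ℕ, b n = x n + (n + (n + α + β) * c - γ) / (1 - c)) ∧
      (∀ n : ℕ, (1 - c) / c * a n ^ 2 =
        y n + (∑ k ∈ Finset.range n, x k) + n * (n + α + β - γ - 1) / (1 - c)) := by
  have hw := HypergeometricWeights.summable_eval_mul_weight hα hβ hγ hc0 hc1
  have hc : c ≠ 0 := hc0.ne'
  have hc' : 1 - c ≠ 0 := (sub_pos.mpr hc1).ne'
  constructor
  · obtain ⟨p, a, b, H, hlc⟩ := HypergeometricWeights.exists_isOrthonormalSystem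
      (L := HypergeometricWeights.weightFunctional _ hw) fun f hf =>
        HypergeometricWeights.weightFunctional_mul_self_pos
          (HypergeometricWeights.weight_pos hα hβ hγ hc0) hf
    refine ⟨p, a, b, _, _, ⟨H.natDegree_eq, hlc, fun m n => ?_⟩, ⟨H.a_zero, H.recurrence⟩,
      HypergeometricWeights.isLadderSequences hα hβ hγ hc0 hc1 H⟩
    have h := HypergeometricWeights.hasSum_weightFunctional (hw := hw) (p m * p n)
    simpa only [H.orthonormal, Polynomial.eval_mul] using h
  · intro p a b x y hp hab hxy
    have H := HypergeometricWeights.isOrthonormalSystem_weightFunctional (hw := hw) hp hab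
    have hP := HypergeometricWeights.weightFunctional_pearson (α := α) (β := β) (c := c)
      (hw := hw) hγ
    obtain ⟨hx, hy⟩ := hxy.eq_ladder hα hβ hγ hc0 hc1 H
    have h2 := H.second_discrete_equation hP hc hc' hx hy
    have hb := HypergeometricWeights.IsOrthonormalSystem.recurrence_coeff_eq hx
    refine ⟨H.first_discrete_equation hP hc hc' hx hy, fun n _ hD => ?_, fun n _ => h2 n, ?_, ?_,
      hb, HypergeometricWeights.IsOrthonormalSystem.recurrence_coeff_sq_eq hc' hx hy⟩
    · rw [← h2 n]
      field_simp
    · simp [hy, HypergeometricWeights.ladderY, H.a_zero]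
    · have h0 := hb 0
      rw [HypergeometricWeights.recurrence_coeff_zero hγ H] at h0
      rw [h0]
      push_cast
      ring
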